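/- Let $\mathbb{F}_q$ be a finite field with $q \geq 4$ elements, let $s, d$ be positive integers with $d < s$, and let $X = (\mathbb{F}_q^*)^s$. Let $I_X \subset \mathbb{F}_q[t_1,\ldots,t_s]$ be the ideal of all polynomials vanishing on $X$ and let $\varphi : \mathbb{F}_q[t_1,\ldots,t_s]/I_X \to \mathbb{F}_q^{X}$, $f + I_X \mapsto (f(P))_{P \in X}$, be the evaluation map. Let $R(d) \subset \mathbb{R}^s$ be the hypersimplex, i.e. the convex hull of $\{e_{i_1} + \cdots + e_{i_d} \mid 1 \leq i_1 < \cdots < i_d \leq s\}$, where $e_1,\ldots,e_s$ is the canonical basis of $\mathbb{R}^s$, and let $C(d) = \varphi(\mathcal{L}(d))$, where $\mathcal{L}(d)$ is the $\mathbb{F}_q$-vector space generated by the classes $t_1^{\alpha_1}\cdots t_s^{\alpha_s} + I_X$ with $(\alpha_1,\ldots,\alpha_s) \in R(d) \cap \mathbb{Z}^s$. The next-to-minimal weight of a code is the second least value taken by the Hamming weight on its nonzero words. If $2d - 2 \geq s$, then the next-to-minimal weight of $C(d)$ is $$(q-2)^{s-d}(q-1)^d + (q-2)^{s-d}(q-1)^{d-2}.$$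 -/

import Mathlib

/-- The affine torus `(F^*)^s`, as a set of points of `F^s`. -/
def torus (F : Type*) [Field F] (s : ℕ) : Set (Fin s → F) :=
  {P | ∀ i, P i ≠ 0}

instance (F : Type*) [Field F] [Fintype F] [DecidableEq F] (s : ℕ) : Fintype (torus F s) :=
  inferInstanceAs (Fintype {P : Fin s → F // ∀ i, P i ≠ 0})

/-- The linear map `F[t_1, …, t_s] → F^X` evaluating a polynomial at all points of `X`. -/
noncomputable def evalOn {F : Type*} [Field F] {s : ℕ} (X : Set (Fin s → F)) :
    MvPolynomial (Fin s) F →ₗ[F] (X → F) :=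
  LinearMap.pi fun P => (MvPolynomial.aeval (P : Fin s → F)).toLinearMap

/-- The evaluation map `φ : F[t_1, …, t_s] / I_X → F^X`, where `I_X` is the ideal of all
polynomials vanishing at all points of `X`. -/
noncomputable def evaluationMap {F : Type*} [Field F] {s : ℕ} (X : Set (Fin s → F)) :
    (MvPolynomial (Fin s) F ⧸ MvPolynomial.vanishingIdeal F X) →ₗ[F] (X → F) :=
  Submodule.liftQ ((MvPolynomial.vanishingIdeal F X).restrictScalars F) (evalOn X) (by
    intro p hp
    rw [LinearMap.mem_ker]
    funext P
    exact hp P P.2)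

/-- The subspace of `F[t_1, …, t_s] / I_X`, with `X = (F^*)^s`, generated by the classes of the
monomials whose exponent vector is a lattice point of `R` (for `R ⊆ [0, q - 2]^s`). -/
noncomputable def toricSpace (F : Type*) [Field F] {s : ℕ} (R : Set (Fin s → ℝ)) :
    Submodule F (MvPolynomial (Fin s) F ⧸ MvPolynomial.vanishingIdeal F (torus F s)) :=
  Submodule.span F
    {y | ∃ α : Fin s →₀ ℕ, (fun i => (α i : ℝ)) ∈ R ∧
      y = Ideal.Quotient.mk (MvPolynomial.vanishingIdeal F (torus F s))
        (MvPolynomial.monomial α (1 : F))}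

/-- The toric code associated to the torus `(F^*)^s` and to `R`. Its words are indexed by the
points of the torus. -/
noncomputable def toricCode (F : Type*) [Field F] {s : ℕ} (R : Set (Fin s → ℝ)) :
    Submodule F (torus F s → F) :=
  (toricSpace F R).map (evaluationMap (torus F s))

/-- The hypersimplex `R(d)` in `ℝ^s`: the convex hull of all sums of `d` distinct vectors of the
canonical basis. -/
def hypersimplex (s d : ℕ) : Set (Fin s → ℝ) :=
  convexHull ℝ {x | ∃ T : Finset (Fin s), T.card = d ∧ x = ∑ i ∈ T, Pi.single i (1 : ℝ)}

/-- The toric code `C(d)` over the hypersimplex `R(d)` in `ℝ^s`. -/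
noncomputable def hypersimplexCode (F : Type*) [Field F] (s d : ℕ) :
    Submodule F (torus F s → F) :=
  toricCode F (hypersimplex s d)

/-- The set of the Hamming weights of the nonzero words of a linear code. -/
def nonzeroWeights {F ι : Type*} [Field F] [DecidableEq F] [Fintype ι]
    (C : Submodule F (ι → F)) : Set ℕ :=
  {w | ∃ v ∈ C, v ≠ 0 ∧ hammingNorm v = w}

/-- `w` is the next-to-minimal weight of `C`, i.e. the second least Hamming weight of the nonzero
words of `C`: the nonzero words have a least weight `δ` (the minimum distance), and `w` is the
least of their weights other than `δ`. -/
def IsNextToMinimalWeight {F ι : Type*} [Field F] [DecidableEq F] [Fintype ι]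
    (C : Submodule F (ι → F)) (w : ℕ) : Prop :=
  ∃ δ, IsLeast (nonzeroWeights C) δ ∧ IsLeast (nonzeroWeights C \ {δ}) w

/-! Write `Q = q - 1` and `N(f)` for the number of nonzeros of `f` on the torus. Inverting all
coordinates and multiplying by their product turns a squarefree monomial into the complementary one
and preserves weights (`map_cremona_hypersimplexCode`, `hammingNorm_eq_torusCount`). So `C(d)` may
be replaced by the squarefree forms of degree `k = s - d`, and `2d - 2 ≥ s` becomes `2k + 2 ≤ s`.

Split `f = t_x g + h` with `g`, `h` free of `t_x`. Counting along `t_x` gives `N(f) ≥ (1 - 1/Q) N(g)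
+ #{h ≠ 0, g = 0}`, and induction on the variables yields the minimum `(1 - 1/Q)^k Q^s`.

For the gap (`torusCount_dichotomy`), the claim is that `f` exceeds the minimum by a factor of at
least `1 + 1/Q^2` or is a product of `k` binomials in disjoint pairs of variables, which has exactly
the minimal weight. By induction `g` may be taken to be such a product. If `g` does not divide `h`,
then `h` has enough nonzeros on the zeros of `g` (`IsBinomialProduct.dvd_or_le_torusCount`).
Otherwise `f = g (t_x + m)` with a linear cofactor in the remaining variables, and only two-term
linear forms fall below the density `(1 - 1/Q)(1 + 1/Q^2)` (`linearDensity_ge`). Four-term forms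
attain it, so `k - 1` binomials times a sum of four other variables realises the second weight. -/

open Finset

set_option linter.unusedSectionVars false

/-! ### Counting torus points one coordinate at a time -/

section SquarefreeForms

variable {ι F : Type*} [Fintype ι] [DecidableEq ι] [Field F] [Fintype F] [DecidableEq F]

open Classical in
/-- The number of points of the torus satisfying `p`, as a real number. -/
noncomputable def torusCount (p : (ι → Fˣ) → Prop) : ℝ :=
  ∑ P : ι → Fˣ, if p P then 1 else 0

open Classical in
theorem torusCount_eq_card (p : (ι → Fˣ) → Prop) :
    torusCount p = ((univ.filter p).card : ℝ) := by
  simp [torusCount]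

theorem torusCount_nonneg (p : (ι → Fˣ) → Prop) : 0 ≤ torusCount p := by
  rw [torusCount_eq_card]; positivity

theorem torusCount_mono {p p' : (ι → Fˣ) → Prop} (h : ∀ P, p P → p' P) :
    torusCount p ≤ torusCount p' := by
  classical
  rw [torusCount_eq_card, torusCount_eq_card]
  exact_mod_cast card_le_card (monotone_filter_right _ (fun P _ => h P))

theorem torusCount_true :
    torusCount (fun _ : ι → Fˣ => True) = (Fintype.card Fˣ : ℝ) ^ Fintype.card ι := by
  simp [torusCount]

/-- Exchanging `u` with the coordinate `P x` is an involution on pairs `(P, u)`. This is the device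
for counting along the lines in direction `x`. -/
theorem sum_sum_update (x : ι) (φ : (ι → Fˣ) → ℝ) :
    ∑ P : ι → Fˣ, ∑ u : Fˣ, φ (Function.update P x u) =
      (Fintype.card Fˣ : ℝ) * ∑ P : ι → Fˣ, φ P := by
  have h : ∑ z : (ι → Fˣ) × Fˣ, φ (Function.update z.1 x z.2) =
      ∑ z : (ι → Fˣ) × Fˣ, φ z.1 := by
    refine Finset.sum_bij' (fun z _ => (Function.update z.1 x z.2, z.1 x))
      (fun z _ => (Function.update z.1 x z.2, z.1 x)) ?_ ?_ ?_ ?_ ?_ <;> simp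
  rw [Fintype.sum_prod_type, Fintype.sum_prod_type] at h
  rw [h, mul_sum]
  simp

open Classical in
theorem card_mul_torusCount (x : ι) (p : (ι → Fˣ) → Prop) :
    (Fintype.card Fˣ : ℝ) * torusCount p =
      ∑ P : ι → Fˣ, ∑ u : Fˣ, if p (Function.update P x u) then (1 : ℝ) else 0 :=
  (sum_sum_update x fun P => if p P then (1 : ℝ) else 0).symm

/-- A line in direction `x` meeting `p` counts `Q` times on the left and at least once in
`torusCount p`: projecting out a coordinate costs a factor `Q`. -/
theorem torusCount_exists_le (x : ι) (p : (ι → Fˣ) → Prop) :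
    torusCount (fun P => ∃ u, p (Function.update P x u)) ≤
      (Fintype.card Fˣ : ℝ) * torusCount p := by
  classical
  rw [card_mul_torusCount x, torusCount]
  refine sum_le_sum fun P _ => ?_
  split_ifs with h
  · obtain ⟨u, hu⟩ := h
    have := single_le_sum (f := fun u => if p (Function.update P x u) then (1 : ℝ) else 0)
      (fun i _ => by positivity) (mem_univ u)
    simpa [hu] using this
  · exact sum_nonneg fun i _ => by positivity

theorem card_units_pos : (0 : ℝ) < Fintype.card Fˣ := by
  exact_mod_cast Fintype.card_pos

/-- The only root `-b / a` is a unit exactly when `b ≠ 0`. -/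
theorem sum_affine_ne_zero {a : F} (ha : a ≠ 0) (b : F)
    [∀ u : Fˣ, Decidable (a * (u : F) + b ≠ 0)] [Decidable (b ≠ 0)] :
    ∑ u : Fˣ, (if a * (u : F) + b ≠ 0 then (1 : ℝ) else 0) =
      (Fintype.card Fˣ : ℝ) - if b ≠ 0 then 1 else 0 := by
  by_cases hb : b = 0
  · simp [hb, ha]
  · classical
    have hc : -b / a ≠ 0 := div_ne_zero (neg_ne_zero.2 hb) ha
    have h : ∀ u : Fˣ, (if a * (u : F) + b ≠ 0 then (1 : ℝ) else 0) =
        1 - if u = Units.mk0 _ hc then 1 else 0 := by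
      intro u
      have : a * (u : F) + b = 0 ↔ u = Units.mk0 _ hc := by
        rw [Units.ext_iff, Units.val_mk0, eq_div_iff ha, mul_comm a, eq_neg_iff_add_eq_zero]
      by_cases h0 : u = Units.mk0 _ hc
      · rw [if_neg (by simpa using this.2 h0), if_pos h0]; norm_num
      · rw [if_pos (by simpa using fun h => h0 (this.1 h)), if_neg h0]; norm_num
    rw [sum_congr rfl fun u _ => h u, sum_sub_distrib]
    simp [hb]

/-- `f` does not depend on the coordinate `x`. -/
def IgnoresCoord {α : Type*} (x : ι) (f : (ι → Fˣ) → α) : Prop :=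
  ∀ P u, f (Function.update P x u) = f P

theorem torusCount_affine {x : ι} {a : F} (ha : a ≠ 0) {m : (ι → Fˣ) → F}
    (hm : IgnoresCoord x m) :
    (Fintype.card Fˣ : ℝ) * torusCount (fun P : ι → Fˣ => a * (P x : F) + m P ≠ 0) =
      (Fintype.card Fˣ : ℝ) * (Fintype.card Fˣ : ℝ) ^ Fintype.card ι -
        torusCount (fun P => m P ≠ 0) := by
  classical
  rw [card_mul_torusCount x, ← torusCount_true]
  simp only [torusCount, Function.update_self]
  rw [mul_sum, ← sum_sub_distrib]
  refine sum_congr rfl fun P _ => ?_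
  simp only [hm P]
  rw [sum_affine_ne_zero ha]
  simp

theorem torusCount_mul_binomial {x y : ι} (hxy : x ≠ y) {a b : F} (ha : a ≠ 0) (hb : b ≠ 0)
    {p : (ι → Fˣ) → Prop} (hp : IgnoresCoord x p) :
    (Fintype.card Fˣ : ℝ) *
        torusCount (fun P : ι → Fˣ => p P ∧ a * (P x : F) + b * (P y : F) ≠ 0) =
      ((Fintype.card Fˣ : ℝ) - 1) * torusCount p := by
  classical
  rw [card_mul_torusCount x, torusCount, mul_sum]
  refine sum_congr rfl fun P _ => ?_
  simp only [Function.update_self, hp P, Function.update_of_ne hxy.symm]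
  by_cases h : p P
  · have := sum_affine_ne_zero ha (b * (P y : F))
    simp only [h, true_and]
    rw [this]
    simp [hb]
  · simp [h]

/-- On a line in direction `x`, at most one value of `P x` is lost where `g ≠ 0`, and none where `g
= 0` and `h ≠ 0`. -/
theorem torusCount_affine_ge {x : ι} {g h : (ι → Fˣ) → F} (hg : IgnoresCoord x g)
    (hh : IgnoresCoord x h) :
    ((Fintype.card Fˣ : ℝ) - 1) * torusCount (fun P => g P ≠ 0) +
        (Fintype.card Fˣ : ℝ) * torusCount (fun P => h P ≠ 0 ∧ g P = 0) ≤
      (Fintype.card Fˣ : ℝ) * torusCount (fun P : ι → Fˣ => (P x : F) * g P + h P ≠ 0) := by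
  classical
  rw [card_mul_torusCount x (fun P : ι → Fˣ => (P x : F) * g P + h P ≠ 0), torusCount, torusCount,
    mul_sum, mul_sum, ← sum_add_distrib]
  refine sum_le_sum fun P _ => ?_
  simp only [Function.update_self, hg P, hh P]
  by_cases h0 : g P = 0
  · by_cases h1 : h P = 0 <;> simp [h0, h1]
  · have := sum_affine_ne_zero h0 (h P)
    simp only [mul_comm _ (g P)]
    rw [this]
    simp only [h0, and_false, if_false, ne_eq, not_false_eq_true, if_true]
    split_ifs <;> simp

/-! ### Squarefree forms and their splitting along one variable -/

variable (F) in
/-- The functions on the torus given by the squarefree forms of degree `k` in the variables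
indexed by `V`. -/
def squarefreeForms (k : ℕ) (V : Finset ι) : Submodule F ((ι → Fˣ) → F) :=
  Submodule.span F {f | ∃ T ⊆ V, T.card = k ∧ f = fun P => ∏ i ∈ T, (P i : F)}

theorem squarefreeForms_mono (k : ℕ) {V W : Finset ι} (h : V ⊆ W) :
    squarefreeForms F k V ≤ squarefreeForms F k W := by
  refine Submodule.span_mono ?_
  rintro f ⟨T, hT, hk, rfl⟩
  exact ⟨T, hT.trans h, hk, rfl⟩

theorem ignoresCoord_of_mem_squarefreeForms {k : ℕ} {V : Finset ι} {f : (ι → Fˣ) → F}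
    (hf : f ∈ squarefreeForms F k V) {x : ι} (hx : x ∉ V) : IgnoresCoord x f := by
  intro P u
  induction hf using Submodule.span_induction with
  | mem f hf =>
    obtain ⟨T, hT, -, rfl⟩ := hf
    refine prod_congr rfl fun i hi => ?_
    rw [Function.update_of_ne]
    rintro rfl
    exact hx (hT hi)
  | zero => rfl
  | add f g _ _ h1 h2 => simp [h1, h2]
  | smul c f _ h => simp [h]

theorem mem_squarefreeForms_zero {V : Finset ι} {f : (ι → Fˣ) → F}
    (hf : f ∈ squarefreeForms F 0 V) : ∃ c, f = fun _ => c := by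
  induction hf using Submodule.span_induction with
  | mem f hf =>
    obtain ⟨T, -, hT, rfl⟩ := hf
    rw [card_eq_zero] at hT
    exact ⟨1, by simp [hT]⟩
  | zero => exact ⟨0, rfl⟩
  | add f g _ _ h1 h2 =>
    obtain ⟨a, rfl⟩ := h1
    obtain ⟨b, rfl⟩ := h2
    exact ⟨a + b, rfl⟩
  | smul c f _ h =>
    obtain ⟨a, rfl⟩ := h
    exact ⟨c * a, rfl⟩

theorem mem_squarefreeForms_succ_empty {k : ℕ} {f : (ι → Fˣ) → F}
    (hf : f ∈ squarefreeForms F (k + 1) ∅) : f = 0 := by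
  have : {f : (ι → Fˣ) → F | ∃ T ⊆ (∅ : Finset ι), T.card = k + 1 ∧
      f = fun P => ∏ i ∈ T, (P i : F)} = ∅ := by
    ext f
    simp only [subset_empty, Set.mem_ofPred_eq, Set.mem_empty_iff_false, iff_false]
    rintro ⟨T, rfl, h, -⟩
    simp at h
  rw [squarefreeForms, this, Submodule.span_empty] at hf
  simpa using hf

theorem exists_of_mem_squarefreeForms_insert {k : ℕ} {V : Finset ι} {x : ι}
    {f : (ι → Fˣ) → F} (hf : f ∈ squarefreeForms F (k + 1) (insert x V)) :
    ∃ g ∈ squarefreeForms F k V, ∃ h ∈ squarefreeForms F (k + 1) V,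
      f = fun P => (P x : F) * g P + h P := by
  induction hf using Submodule.span_induction with
  | mem f hf =>
    obtain ⟨T, hTV, hT, rfl⟩ := hf
    by_cases hxT : x ∈ T
    · refine ⟨fun P => ∏ i ∈ T.erase x, (P i : F),
        Submodule.subset_span ⟨T.erase x, ?_, ?_, rfl⟩, 0, zero_mem _, ?_⟩
      · rwa [← subset_insert_iff]
      · rw [card_erase_of_mem hxT, hT]; rfl
      · ext P
        simp only [Pi.zero_apply, add_zero]
        exact (mul_prod_erase T (fun i => (P i : F)) hxT).symm
    · refine ⟨0, zero_mem _, fun P => ∏ i ∈ T, (P i : F),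
        Submodule.subset_span ⟨T, (subset_insert_iff_of_notMem hxT).1 hTV, hT, rfl⟩, ?_⟩
      simp
  | zero => exact ⟨0, zero_mem _, 0, zero_mem _, by ext; simp⟩
  | add f f' _ _ h1 h2 =>
    obtain ⟨g, hg, h, hh, rfl⟩ := h1
    obtain ⟨g', hg', h', hh', rfl⟩ := h2
    refine ⟨_, add_mem hg hg', _, add_mem hh hh', ?_⟩
    ext P
    simp only [Pi.add_apply]
    ring
  | smul c f _ h =>
    obtain ⟨g, hg, h, hh, rfl⟩ := h
    refine ⟨_, Submodule.smul_mem _ c hg, _, Submodule.smul_mem _ c hh, ?_⟩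
    ext P
    simp only [Pi.smul_apply, smul_eq_mul]
    ring

theorem mul_mem_squarefreeForms {j k : ℕ} {V W : Finset ι} (hVW : Disjoint V W)
    {f g : (ι → Fˣ) → F} (hf : f ∈ squarefreeForms F j V) (hg : g ∈ squarefreeForms F k W) :
    f * g ∈ squarefreeForms F (j + k) (V ∪ W) := by
  induction hf using Submodule.span_induction with
  | mem f hf =>
    obtain ⟨T, hTV, hT, rfl⟩ := hf
    induction hg using Submodule.span_induction with
    | mem g hg =>
      obtain ⟨U, hUW, hU, rfl⟩ := hg
      have hd := disjoint_of_subset_left hTV (disjoint_of_subset_right hUW hVW)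
      refine Submodule.subset_span ⟨T ∪ U, union_subset_union hTV hUW, ?_, ?_⟩
      · rw [card_union_of_disjoint hd, hT, hU]
      · ext P
        simp [prod_union hd]
    | zero => simp
    | add f f' _ _ h1 h2 => rw [mul_add]; exact add_mem h1 h2
    | smul c f _ h => rw [mul_smul_comm]; exact Submodule.smul_mem _ c h
  | zero => simp
  | add f f' _ _ h1 h2 => rw [add_mul]; exact add_mem h1 h2
  | smul c f _ h => rw [smul_mul_assoc]; exact Submodule.smul_mem _ c h

theorem coord_mem_squarefreeForms {V : Finset ι} {x : ι} (hx : x ∈ V) :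
    (fun P : ι → Fˣ => (P x : F)) ∈ squarefreeForms F 1 V :=
  Submodule.subset_span ⟨{x}, by simpa using hx, by simp, by simp⟩

theorem linearForm_mem_squarefreeForms {V S : Finset ι} (hS : S ⊆ V) (a : ι → F) :
    (fun P : ι → Fˣ => ∑ i ∈ S, a i * (P i : F)) ∈ squarefreeForms F 1 V := by
  have : (fun P : ι → Fˣ => ∑ i ∈ S, a i * (P i : F)) =
      ∑ i ∈ S, a i • (fun P : ι → Fˣ => (P i : F)) := by
    ext P; simp
  rw [this]
  exact sum_mem fun i hi => Submodule.smul_mem _ _ (coord_mem_squarefreeForms (hS hi))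

theorem exists_linearForm_of_mem {V : Finset ι} {m : (ι → Fˣ) → F}
    (hm : m ∈ squarefreeForms F 1 V) :
    ∃ (a : ι → F) (S : Finset ι), S ⊆ V ∧ (∀ i ∈ S, a i ≠ 0) ∧
      m = fun P => ∑ i ∈ S, a i * (P i : F) := by
  have h : ∃ a : ι → F, m = fun P => ∑ i ∈ V, a i * (P i : F) := by
    induction hm using Submodule.span_induction with
    | mem f hf =>
      obtain ⟨T, hTV, hT, rfl⟩ := hf
      obtain ⟨x, rfl⟩ := card_eq_one.1 hT
      refine ⟨Pi.single x 1, ?_⟩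
      ext P
      rw [singleton_subset_iff] at hTV
      simp [Pi.single_apply, hTV]
    | zero => exact ⟨0, by ext; simp⟩
    | add f g _ _ h1 h2 =>
      obtain ⟨a, rfl⟩ := h1
      obtain ⟨b, rfl⟩ := h2
      exact ⟨a + b, by ext P; simp [add_mul, sum_add_distrib]⟩
    | smul c f _ h =>
      obtain ⟨a, rfl⟩ := h
      exact ⟨c • a, by ext P; simp [mul_sum, mul_assoc]⟩
  obtain ⟨a, rfl⟩ := h
  refine ⟨a, V.filter (fun i => a i ≠ 0), filter_subset _ _, fun i hi => (mem_filter.1 hi).2, ?_⟩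
  ext P
  rw [sum_filter]
  refine sum_congr rfl fun i _ => ?_
  by_cases h : a i = 0 <;> simp [h]

/-! ### Weights of linear forms -/

/-- The proportion of nonzeros on the torus of a linear form with `t` terms, over a field with
`Q` units. -/
noncomputable def linearDensity (Q : ℝ) : ℕ → ℝ
  | 0 => 0
  | t + 1 => 1 - linearDensity Q t / Q

theorem torusCount_linearForm (a : ι → F) (S : Finset ι) (ha : ∀ i ∈ S, a i ≠ 0) :
    torusCount (fun P : ι → Fˣ => ∑ i ∈ S, a i * (P i : F) ≠ 0) =
      linearDensity (Fintype.card Fˣ) S.card * (Fintype.card Fˣ : ℝ) ^ Fintype.card ι := by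
  have hQ : (0 : ℝ) < Fintype.card Fˣ := card_units_pos
  induction S using Finset.induction_on with
  | empty => simp [torusCount, linearDensity]
  | insert x S hx ih =>
    have h1 := torusCount_affine (ha x (mem_insert_self x S))
      (ignoresCoord_of_mem_squarefreeForms (linearForm_mem_squarefreeForms subset_rfl a) hx)
    rw [ih fun i hi => ha i (mem_insert_of_mem hi)] at h1
    simp only [sum_insert hx, card_insert_of_notMem hx, linearDensity]
    refine mul_left_cancel₀ hQ.ne' (h1.trans ?_)
    field_simp

theorem linearDensity_four {Q : ℝ} (hQ : 0 < Q) :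
    linearDensity Q 4 = (1 - 1 / Q) * (1 + 1 / Q ^ 2) := by
  simp only [linearDensity]
  field_simp
  ring

/-- The densities alternate around their limit with shrinking oscillation: from `t = 3` on they stay
between the values at 4 and 3, and the value at 1 is 1. The lower bound is the value at 4. -/
theorem linearDensity_ge {Q : ℝ} (hQ : 1 ≤ Q) {t : ℕ} (h0 : t ≠ 0) (h2 : t ≠ 2) :
    (1 - 1 / Q) * (1 + 1 / Q ^ 2) ≤ linearDensity Q t := by
  have hQ0 : 0 < Q := by linarith
  have hi : 1 / Q ≤ 1 := by rwa [div_le_one hQ0]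
  have hi0 : 0 < 1 / Q := by positivity
  set z := 1 / Q with hz
  have hz2 : 1 / Q ^ 2 = z ^ 2 := by rw [hz, div_pow, one_pow]
  have hrec : ∀ t, linearDensity Q (t + 1) = 1 - linearDensity Q t * z := by
    intro t; rw [linearDensity, hz]; ring
  have h3 : linearDensity Q 3 = 1 - (1 - z) * z := by
    rw [hrec, hrec, hrec, linearDensity]; ring
  rw [hz2]
  have key : ∀ t, (1 - z) * (1 + z ^ 2) ≤ linearDensity Q (t + 3) ∧
      linearDensity Q (t + 3) ≤ 1 - (1 - z) * z := by
    intro t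
    induction t with
    | zero =>
      rw [h3]
      exact ⟨by nlinarith [pow_pos hi0 3], le_rfl⟩
    | succ t ih =>
      rw [show t + 1 + 3 = (t + 3) + 1 by ring, hrec]
      have h1 := mul_le_mul_of_nonneg_right ih.1 hi0.le
      have h2 := mul_le_mul_of_nonneg_right ih.2 hi0.le
      -- The order-reversing map `λ ↦ 1 - λ z` sends the upper end exactly to the lower end, and the
      -- lower end to a point this far below the upper end.
      have h4 : 0 ≤ (1 - z) * z ^ 3 := mul_nonneg (by linarith) (by positivity)
      constructor <;> nlinarith
  match t with
  | 1 =>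
    rw [hrec, linearDensity]
    nlinarith [pow_pos hi0 3, mul_nonneg hi0.le (sub_nonneg.2 hi)]
  | t + 3 => exact (key t).1

theorem torusCount_linearForm_dichotomy {V : Finset ι} {m : (ι → Fˣ) → F}
    (hm : m ∈ squarefreeForms F 1 V) (hm0 : m ≠ 0) :
    (1 - 1 / (Fintype.card Fˣ : ℝ)) * (1 + 1 / (Fintype.card Fˣ : ℝ) ^ 2) *
        (Fintype.card Fˣ : ℝ) ^ Fintype.card ι ≤ torusCount (fun P => m P ≠ 0) ∨
      ∃ x ∈ V, ∃ y ∈ V, x ≠ y ∧ ∃ a b : F, a ≠ 0 ∧ b ≠ 0 ∧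
        m = fun P => a * (P x : F) + b * (P y : F) := by
  obtain ⟨a, S, hSV, ha, rfl⟩ := exists_linearForm_of_mem hm
  by_cases h2 : S.card = 2
  · right
    obtain ⟨x, y, hxy, rfl⟩ := card_eq_two.1 h2
    exact ⟨x, hSV (by simp), y, hSV (by simp), hxy, a x, a y, ha x (by simp), ha y (by simp),
      by ext P; rw [sum_pair hxy]⟩
  · left
    have h0 : S.card ≠ 0 := by
      rintro h
      rw [card_eq_zero] at h
      exact hm0 (by ext; simp [h])
    rw [torusCount_linearForm a S ha]
    refine mul_le_mul_of_nonneg_right (linearDensity_ge ?_ h0 h2) (by positivity)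
    exact_mod_cast Fintype.card_pos (α := Fˣ)

/-! ### The minimum weight -/

theorem torusCount_const_ne_zero {f : (ι → Fˣ) → F} (hf0 : f ≠ 0) {V : Finset ι}
    (hf : f ∈ squarefreeForms F 0 V) :
    torusCount (fun P => f P ≠ 0) = (Fintype.card Fˣ : ℝ) ^ Fintype.card ι := by
  obtain ⟨c, rfl⟩ := mem_squarefreeForms_zero hf
  have hc : c ≠ 0 := fun h => hf0 (by ext; simp [h])
  simp [hc, torusCount_true]

theorem one_sub_one_div_card_units_mul :
    (Fintype.card Fˣ : ℝ) * (1 - 1 / (Fintype.card Fˣ : ℝ)) = (Fintype.card Fˣ : ℝ) - 1 := by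
  have hQ : (0 : ℝ) < Fintype.card Fˣ := card_units_pos
  field_simp

theorem one_sub_one_div_card_units_nonneg : 0 ≤ 1 - 1 / (Fintype.card Fˣ : ℝ) := by
  have hQ1 : (1 : ℝ) ≤ Fintype.card Fˣ := by exact_mod_cast Fintype.card_pos (α := Fˣ)
  rw [sub_nonneg, div_le_one (by linarith)]
  exact hQ1

theorem le_torusCount_affine {x : ι} {g h : (ι → Fˣ) → F} (hg : IgnoresCoord x g)
    (hh : IgnoresCoord x h) :
    (1 - 1 / (Fintype.card Fˣ : ℝ)) * torusCount (fun P => g P ≠ 0) +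
        torusCount (fun P => h P ≠ 0 ∧ g P = 0) ≤
      torusCount (fun P : ι → Fˣ => (P x : F) * g P + h P ≠ 0) := by
  have hQ : (0 : ℝ) < Fintype.card Fˣ := card_units_pos
  refine le_of_mul_le_mul_left (le_trans (le_of_eq ?_) (torusCount_affine_ge hg hh)) hQ
  rw [mul_add, ← mul_assoc, one_sub_one_div_card_units_mul]

theorem le_torusCount_of_mem_squarefreeForms {k : ℕ} {V : Finset ι} {f : (ι → Fˣ) → F}
    (hf : f ∈ squarefreeForms F k V) (hf0 : f ≠ 0) :
    (1 - 1 / (Fintype.card Fˣ : ℝ)) ^ k * (Fintype.card Fˣ : ℝ) ^ Fintype.card ι ≤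
      torusCount (fun P => f P ≠ 0) := by
  induction V using Finset.induction_on generalizing k f with
  | empty =>
    cases k with
    | zero => rw [torusCount_const_ne_zero hf0 hf]; simp
    | succ k => exact absurd (mem_squarefreeForms_succ_empty hf) hf0
  | insert x V hx ih =>
    cases k with
    | zero => rw [torusCount_const_ne_zero hf0 hf]; simp
    | succ k =>
      obtain ⟨g, hg, h, hh, rfl⟩ := exists_of_mem_squarefreeForms_insert hf
      by_cases hg0 : g = 0
      · subst hg0
        have hh0 : h ≠ 0 := by
          rintro rfl
          exact hf0 (by ext; simp)
        simpa using ih hh hh0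
      · have h2 := le_torusCount_affine (ignoresCoord_of_mem_squarefreeForms hg hx)
          (ignoresCoord_of_mem_squarefreeForms hh hx)
        have h3 := torusCount_nonneg (fun P => h P ≠ 0 ∧ g P = 0)
        have h5 := mul_le_mul_of_nonneg_left (ih hg hg0)
          (one_sub_one_div_card_units_nonneg (F := F))
        rw [pow_succ']
        linarith

end SquarefreeForms
-- Products of binomials in disjoint pairs of variables
section BinomialProducts

variable {ι F : Type*} [Fintype ι] [DecidableEq ι] [Field F] [Fintype F] [DecidableEq F]

/-- `f` is, up to a nonzero scalar, the product of `k` binomials `a t_x + b t_y` in pairwise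
disjoint pairs of variables, the union of the pairs being `W`. -/
inductive IsBinomialProduct : ℕ → Finset ι → ((ι → Fˣ) → F) → Prop
  | const {c : F} (hc : c ≠ 0) : IsBinomialProduct 0 ∅ (fun _ => c)
  | mul {k : ℕ} {W : Finset ι} {g : (ι → Fˣ) → F} {x y : ι} {a b : F}
      (hg : IsBinomialProduct k W g) (hx : x ∉ W) (hy : y ∉ W) (hxy : x ≠ y)
      (ha : a ≠ 0) (hb : b ≠ 0) :
      IsBinomialProduct (k + 1) (insert x (insert y W))
        (fun P => g P * (a * (P x : F) + b * (P y : F)))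

theorem IsBinomialProduct.ignoresCoord {k : ℕ} {W : Finset ι} {g : (ι → Fˣ) → F}
    (hg : IsBinomialProduct k W g) {z : ι} (hz : z ∉ W) : IgnoresCoord z g := by
  induction hg with
  | const => intro P u; rfl
  | mul hg hx hy hxy ha hb ih =>
    simp only [mem_insert, not_or] at hz
    intro P u
    simp only [ih hz.2.2 P u, Function.update_of_ne (Ne.symm hz.1),
      Function.update_of_ne (Ne.symm hz.2.1)]

/-- Each binomial excludes one value of its first variable in `Q`, independently of any condition on
the variables outside `W`. -/
theorem IsBinomialProduct.torusCount_and {k : ℕ} {W : Finset ι} {g : (ι → Fˣ) → F}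
    (hg : IsBinomialProduct k W g) {p : (ι → Fˣ) → Prop} (hp : ∀ x ∈ W, IgnoresCoord x p) :
    torusCount (fun P => p P ∧ g P ≠ 0) =
      (1 - 1 / (Fintype.card Fˣ : ℝ)) ^ k * torusCount p := by
  induction hg generalizing p with
  | const hc => simp [hc]
  | @mul k W g x y a b hg hx hy hxy ha hb ih =>
    have hQ : (0 : ℝ) < Fintype.card Fˣ := card_units_pos
    have h1 := ih (p := fun P => p P ∧ a * (P x : F) + b * (P y : F) ≠ 0) (by
      intro z hz P u
      have hzx : x ≠ z := fun h => hx (h ▸ hz)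
      have hzy : y ≠ z := fun h => hy (h ▸ hz)
      simp only [hp z (by simp [hz]) P u, Function.update_of_ne hzx, Function.update_of_ne hzy])
    have h2 := torusCount_mul_binomial hxy ha hb (hp x (by simp))
    rw [← one_sub_one_div_card_units_mul, mul_assoc] at h2
    rw [pow_succ, mul_assoc, ← mul_left_cancel₀ hQ.ne' h2, ← h1]
    congr 1
    ext P
    rw [mul_ne_zero_iff]
    tauto

theorem IsBinomialProduct.torusCount_ne_zero {k : ℕ} {W : Finset ι} {g : (ι → Fˣ) → F}
    (hg : IsBinomialProduct k W g) :
    torusCount (fun P => g P ≠ 0) =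
      (1 - 1 / (Fintype.card Fˣ : ℝ)) ^ k * (Fintype.card Fˣ : ℝ) ^ Fintype.card ι := by
  have := hg.torusCount_and (p := fun _ => True) (fun _ _ _ _ => rfl)
  rw [torusCount_true] at this
  simpa using this

theorem IsBinomialProduct.mem_squarefreeForms {k : ℕ} {W : Finset ι} {g : (ι → Fˣ) → F}
    (hg : IsBinomialProduct k W g) : g ∈ squarefreeForms F k W := by
  induction hg with
  | @const c hc =>
    have : (fun _ : ι → Fˣ => (1 : F)) ∈ squarefreeForms F 0 (∅ : Finset ι) :=
      Submodule.subset_span ⟨∅, by simp⟩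
    simpa [Pi.smul_def] using Submodule.smul_mem _ c this
  | @mul k W g x y a b hg hx hy hxy ha hb ih =>
    have hl : (fun P : ι → Fˣ => a * (P x : F) + b * (P y : F)) ∈ squarefreeForms F 1 {x, y} :=
      add_mem (Submodule.smul_mem _ a (coord_mem_squarefreeForms (by simp)))
        (Submodule.smul_mem _ b (coord_mem_squarefreeForms (by simp)))
    have hd : Disjoint W {x, y} := by simp [hx, hy]
    have hW : insert x (insert y W) = W ∪ {x, y} := by
      ext z
      simp only [mem_insert, mem_union, mem_singleton]
      tauto
    rw [hW]
    exact mul_mem_squarefreeForms hd ih hl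

theorem IsBinomialProduct.card {k : ℕ} {W : Finset ι} {g : (ι → Fˣ) → F}
    (hg : IsBinomialProduct k W g) : W.card = 2 * k := by
  induction hg with
  | const => rfl
  | mul hg hx hy hxy ha hb ih =>
    rw [card_insert_of_notMem (by simp [hx, hxy]), card_insert_of_notMem hy, ih]
    ring

theorem exists_isBinomialProduct (k : ℕ) (hk : 2 * k ≤ Fintype.card ι) :
    ∃ (W : Finset ι) (g : (ι → Fˣ) → F), IsBinomialProduct k W g := by
  induction k with
  | zero => exact ⟨∅, _, .const one_ne_zero⟩
  | succ k ih =>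
    obtain ⟨W, g, hg⟩ := ih (by omega)
    have h1 : 1 < (Wᶜ).card := by rw [card_compl, hg.card]; omega
    obtain ⟨x, hx, y, hy, hxy⟩ := one_lt_card.1 h1
    rw [mem_compl] at hx hy
    exact ⟨_, _, hg.mul hx hy hxy one_ne_zero one_ne_zero⟩

/-- A quadratic with three roots is zero; the three units needed are what `q ≥ 4` provides. -/
theorem quadratic_coeffs_eq_zero (h3 : 3 ≤ Fintype.card Fˣ) {a b c : F}
    (h : ∀ v : Fˣ, a * (v : F) ^ 2 + b * v + c = 0) : a = 0 ∧ b = 0 ∧ c = 0 := by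
  obtain ⟨u, v, w, huv, huw, hvw⟩ := Fintype.two_lt_card_iff.1 h3
  have huv' : (u : F) - v ≠ 0 := sub_ne_zero.2 fun h => huv (Units.ext h)
  have huw' : (u : F) - w ≠ 0 := sub_ne_zero.2 fun h => huw (Units.ext h)
  have hvw' : (v : F) - w ≠ 0 := sub_ne_zero.2 fun h => hvw (Units.ext h)
  have e1 : a * (u + v) + b = 0 := by
    refine (mul_eq_zero.1 ?_).resolve_left huv'
    linear_combination h u - h v
  have e2 : a * (u + w) + b = 0 := by
    refine (mul_eq_zero.1 ?_).resolve_left huw'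
    linear_combination h u - h w
  have ha : a = 0 := by
    refine (mul_eq_zero.1 ?_).resolve_left hvw'
    linear_combination e1 - e2
  have hb : b = 0 := by simpa [ha] using e1
  exact ⟨ha, hb, by simpa [ha, hb] using h u⟩

/-- A squarefree form is either divisible by a given binomial or has many nonzeros among the zeros
of that binomial. -/
theorem dvd_binomial_or_le_torusCount (h3 : 3 ≤ Fintype.card Fˣ) {k : ℕ} {V : Finset ι}
    {x y : ι} (hx : x ∈ V) (hy : y ∈ V) (hxy : x ≠ y) {a b : F} (ha : a ≠ 0) (hb : b ≠ 0)
    {h : (ι → Fˣ) → F} (hh : h ∈ squarefreeForms F (k + 2) V) :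
    (1 - 1 / (Fintype.card Fˣ : ℝ)) ^ (k + 2) * (Fintype.card Fˣ : ℝ) ^ Fintype.card ι ≤
        (Fintype.card Fˣ : ℝ) ^ 2 *
          torusCount (fun P => h P ≠ 0 ∧ a * (P x : F) + b * (P y : F) = 0) ∨
      ∃ m ∈ squarefreeForms F (k + 1) ((V.erase x).erase y),
        h = fun P => m P * (a * (P x : F) + b * (P y : F)) := by
  set U := (V.erase x).erase y with hU
  have hV : V = insert x (insert y U) := by
    rw [hU, insert_erase (mem_erase.2 ⟨hxy.symm, hy⟩), insert_erase hx]
  have hxU : x ∉ U := by simp [hU]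
  have hyU : y ∉ U := by simp [hU]
  have hQ : (0 : ℝ) < Fintype.card Fˣ := card_units_pos
  have hQ1 : (1 : ℝ) ≤ Fintype.card Fˣ := by exact_mod_cast Fintype.card_pos (α := Fˣ)
  rw [hV] at hh
  obtain ⟨g, hg, h', hh', rfl⟩ := exists_of_mem_squarefreeForms_insert hh
  obtain ⟨A, hA, B, hB, rfl⟩ := exists_of_mem_squarefreeForms_insert hg
  obtain ⟨C, hC, D, hD, rfl⟩ := exists_of_mem_squarefreeForms_insert hh'
  have iA := fun z (hz : z ∉ U) => ignoresCoord_of_mem_squarefreeForms hA hz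
  have iB := fun z (hz : z ∉ U) => ignoresCoord_of_mem_squarefreeForms hB hz
  have iC := fun z (hz : z ∉ U) => ignoresCoord_of_mem_squarefreeForms hC hz
  have iD := fun z (hz : z ∉ U) => ignoresCoord_of_mem_squarefreeForms hD hz
  -- Here `h = t_x t_y A + t_x B + t_y C + D`. The zeros of the binomial are `t_x = c t_y`, where
  -- `h` becomes `c A t_y ^ 2 + E t_y + D` with `E = c B + C`.
  set c : F := -(b / a) with hc
  have hc0 : c ≠ 0 := neg_ne_zero.2 (div_ne_zero hb ha)
  have hcab : a * c = -b := by rw [hc]; field_simp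
  set E := c • B + C with hE
  have hEm : E ∈ squarefreeForms F (k + 1) U := add_mem (Submodule.smul_mem _ c hB) hC
  set p : (ι → Fˣ) → Prop := fun P => (P x : F) * ((P y : F) * A P + B P) +
    ((P y : F) * C P + D P) ≠ 0 ∧ a * (P x : F) + b * (P y : F) = 0 with hp
  -- Wherever a coefficient is nonzero, the quadratic is nonzero at some unit `t_y`, so `p` holds
  -- after changing two coordinates; projecting them out costs `Q ^ 2`.
  have hp_le : torusCount (fun P => A P ≠ 0 ∨ E P ≠ 0 ∨ D P ≠ 0) ≤
      (Fintype.card Fˣ : ℝ) ^ 2 * torusCount p := by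
    have h1 := torusCount_exists_le x p
    have h2 := torusCount_exists_le y (fun P => ∃ u, p (Function.update P x u))
    have h4 := mul_le_mul_of_nonneg_left h1 hQ.le
    rw [← mul_assoc, ← pow_two] at h4
    refine (torusCount_mono fun P hP => ?_).trans (h2.trans h4)
    by_contra! hno
    have hz := quadratic_coeffs_eq_zero h3 (a := c * A P) (b := E P) (c := D P) (by
      intro v
      by_contra hv
      refine hno v (Units.mk0 c hc0 * v) ?_
      simp only [hp, Function.update_self, iA x hxU _ _, iB x hxU _ _, iC x hxU _ _, iD x hxU _ _,
        iA y hyU _ _, iB y hyU _ _, iC y hyU _ _, iD y hyU _ _, Function.update_of_ne hxy.symm,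
        Units.val_mul, Units.val_mk0]
      refine ⟨fun h0 => hv ?_, by linear_combination (v : F) * hcab⟩
      simp only [hE, Pi.add_apply, Pi.smul_apply, smul_eq_mul]
      linear_combination h0)
    simp only [mul_eq_zero, hc0, false_or] at hz
    tauto
  have hr0 := one_sub_one_div_card_units_nonneg (F := F)
  have hr1 : 1 - 1 / (Fintype.card Fˣ : ℝ) ≤ 1 := by
    have : 0 ≤ 1 / (Fintype.card Fˣ : ℝ) := by positivity
    linarith
  -- The coefficients `A`, `E`, `D` have degrees `k`, `k + 1`, `k + 2`; a lower degree only improves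
  -- the minimum-weight bound.
  have hle : ∀ j ≤ k + 2, ∀ f ∈ squarefreeForms F j U, f ≠ 0 →
      (∀ P, f P ≠ 0 → A P ≠ 0 ∨ E P ≠ 0 ∨ D P ≠ 0) →
      (1 - 1 / (Fintype.card Fˣ : ℝ)) ^ (k + 2) * (Fintype.card Fˣ : ℝ) ^ Fintype.card ι ≤
        (Fintype.card Fˣ : ℝ) ^ 2 * torusCount p := by
    intro j hj f hf hf0 himp
    refine le_trans (mul_le_mul_of_nonneg_right (pow_le_pow_of_le_one hr0 hr1 hj)
      (by positivity)) ?_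
    exact (le_torusCount_of_mem_squarefreeForms hf hf0).trans
      ((torusCount_mono himp).trans hp_le)
  by_cases hA0 : A = 0
  · by_cases hE0 : E = 0
    · by_cases hD0 : D = 0
      · right
        -- Now `C = -c B`, so `h = B (t_x - c t_y)`.
        refine ⟨a⁻¹ • B, Submodule.smul_mem _ _ hB, ?_⟩
        ext P
        have hEP : c * B P + C P = 0 := congrFun hE0 P
        simp only [hA0, hD0, Pi.zero_apply, Pi.smul_apply, smul_eq_mul, mul_zero, zero_add,
          add_zero]
        have : C P = -(c * B P) := by linear_combination hEP
        rw [this, hc]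
        field_simp
      · exact Or.inl (hle _ le_rfl D hD hD0 (by tauto))
    · exact Or.inl (hle _ (by omega) E hEm hE0 (by tauto))
  · exact Or.inl (hle _ (by omega) A hA hA0 (by tauto))

/-- A squarefree form of degree `j + 1` is either divisible by a given product of `j` binomials or
has many nonzeros among the zeros of that product. -/
theorem IsBinomialProduct.dvd_or_le_torusCount (h3 : 3 ≤ Fintype.card Fˣ) {j : ℕ}
    {V W : Finset ι} {g h : (ι → Fˣ) → F} (hg : IsBinomialProduct j W g) (hWV : W ⊆ V)
    (hh : h ∈ squarefreeForms F (j + 1) V) :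
    (1 - 1 / (Fintype.card Fˣ : ℝ)) ^ (j + 1) * (Fintype.card Fˣ : ℝ) ^ Fintype.card ι ≤
        (Fintype.card Fˣ : ℝ) ^ 2 * torusCount (fun P => h P ≠ 0 ∧ g P = 0) ∨
      ∃ m ∈ squarefreeForms F 1 (V \ W), h = fun P => g P * m P := by
  induction hg generalizing V h with
  | @const c hc =>
    right
    refine ⟨c⁻¹ • h, by simpa using Submodule.smul_mem _ _ hh, ?_⟩
    ext P
    simp [hc]
  | @mul j W g x y a b hg hx hy hxy ha hb ih =>
    have hQ : (0 : ℝ) < Fintype.card Fˣ := card_units_pos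
    have hxV : x ∈ V := hWV (by simp)
    have hyV : y ∈ V := hWV (by simp)
    rcases dvd_binomial_or_le_torusCount h3 hxV hyV hxy ha hb hh with h1 | ⟨B, hB, rfl⟩
    · left
      refine h1.trans (mul_le_mul_of_nonneg_left (torusCount_mono ?_) (by positivity))
      rintro P ⟨hP1, hP2⟩
      exact ⟨hP1, by simp only [hP2, mul_zero]⟩
    · have hWU : W ⊆ (V.erase x).erase y := by
        intro z hz
        have hzx : z ≠ x := fun h => hx (h ▸ hz)
        have hzy : z ≠ y := fun h => hy (h ▸ hz)
        simp [hzx, hzy, hWV (mem_insert_of_mem (mem_insert_of_mem hz))]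
      rcases ih hWU hB with h1 | ⟨m, hm, rfl⟩
      · left
        -- Neither `B` nor `g` involves `t_x`, so restoring the binomial factor of `h` multiplies
        -- the count by exactly `1 - 1/Q`, which raises the exponent by one.
        have h2 := torusCount_mul_binomial hxy ha hb
          (p := fun P => B P ≠ 0 ∧ g P = 0) (by
            intro P u
            simp only [hg.ignoresCoord hx P u,
              ignoresCoord_of_mem_squarefreeForms hB (x := x) (by simp) P u])
        rw [← one_sub_one_div_card_units_mul, mul_assoc] at h2
        have h4 := mul_left_cancel₀ hQ.ne' h2
        have h5 := mul_le_mul_of_nonneg_left h1 (one_sub_one_div_card_units_nonneg (F := F))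
        rw [mul_left_comm _ (_ ^ 2 : ℝ), ← h4, ← mul_assoc, ← pow_succ'] at h5
        refine h5.trans (mul_le_mul_of_nonneg_left (torusCount_mono ?_) (by positivity))
        rintro P ⟨⟨hP1, hP2⟩, hP3⟩
        exact ⟨mul_ne_zero hP1 hP3, by simp only [hP2, zero_mul]⟩
      · right
        refine ⟨m, ?_, ?_⟩
        · convert hm using 2
          ext z
          simp only [mem_sdiff, mem_insert, mem_erase]
          tauto
        · ext P
          ring

/-! ### The gap above the minimum, and words attaining both weights -/

/-- The number of nonzeros of a squarefree form of degree `k` is either the least possible one, or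
exceeds it by a factor of at least `1 + 1 / (q - 1) ^ 2`. -/
theorem torusCount_dichotomy (h3 : 3 ≤ Fintype.card Fˣ) {k : ℕ} {V : Finset ι}
    {f : (ι → Fˣ) → F} (hf : f ∈ squarefreeForms F k V) (hf0 : f ≠ 0) :
    (1 - 1 / (Fintype.card Fˣ : ℝ)) ^ k * (1 + 1 / (Fintype.card Fˣ : ℝ) ^ 2) *
        (Fintype.card Fˣ : ℝ) ^ Fintype.card ι ≤ torusCount (fun P => f P ≠ 0) ∨
      ∃ W ⊆ V, IsBinomialProduct k W f := by
  have hconst {V : Finset ι} {f : (ι → Fˣ) → F} (hf : f ∈ squarefreeForms F 0 V) (hf0 : f ≠ 0) :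
      ∃ W ⊆ V, IsBinomialProduct 0 W f := by
    obtain ⟨c, rfl⟩ := mem_squarefreeForms_zero hf
    exact ⟨∅, empty_subset _, .const fun h => hf0 (by ext; simp [h])⟩
  induction V using Finset.induction_on generalizing k f with
  | empty =>
    cases k with
    | zero => exact Or.inr (hconst hf hf0)
    | succ k => exact absurd (mem_squarefreeForms_succ_empty hf) hf0
  | insert x V hx ih =>
    cases k with
    | zero => exact Or.inr (hconst hf hf0)
    | succ k =>
      have hQ : (0 : ℝ) < Fintype.card Fˣ := card_units_pos
      obtain ⟨g, hg, h, hh, rfl⟩ := exists_of_mem_squarefreeForms_insert hf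
      by_cases hg0 : g = 0
      · subst hg0
        have hh0 : h ≠ 0 := by
          rintro rfl
          exact hf0 (by ext; simp)
        rcases ih hh hh0 with h1 | ⟨W, hW, h1⟩
        · left
          simpa using h1
        · exact Or.inr ⟨W, hW.trans (subset_insert _ _), by simpa using h1⟩
      · have h2 := le_torusCount_affine (ignoresCoord_of_mem_squarefreeForms hg hx)
          (ignoresCoord_of_mem_squarefreeForms hh hx)
        have hr := one_sub_one_div_card_units_nonneg (F := F)
        rcases ih hg hg0 with h1 | ⟨W, hW, h1⟩
        · left
          have h4 := torusCount_nonneg (fun P => h P ≠ 0 ∧ g P = 0)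
          have h5 := mul_le_mul_of_nonneg_left h1 hr
          rw [pow_succ']
          linarith
        · rcases h1.dvd_or_le_torusCount h3 hW hh with h4 | ⟨m, hm, rfl⟩
          · left
            -- The first term of `h2` is already the minimum for degree `k + 1`; the nonzeros of `h`
            -- on the zeros of `g` add the missing fraction `1/Q ^ 2` of it.
            rw [h1.torusCount_ne_zero] at h2
            have h5 : (1 - 1 / (Fintype.card Fˣ : ℝ)) ^ (k + 1) *
                (Fintype.card Fˣ : ℝ) ^ Fintype.card ι / (Fintype.card Fˣ : ℝ) ^ 2 ≤
                  torusCount (fun P => h P ≠ 0 ∧ g P = 0) := by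
              rw [div_le_iff₀' (by positivity)]
              exact h4
            refine le_trans (le_of_eq ?_) ((add_le_add_right h5 _).trans h2)
            ring
          · have hfac : (fun P : ι → Fˣ => (P x : F) * g P + g P * m P) =
                fun P => g P * ((P x : F) + m P) := by
              ext P; ring
            rw [hfac] at hf0 ⊢
            have hl : (fun P : ι → Fˣ => (P x : F) + m P) ∈
                squarefreeForms F 1 (insert x V \ W) := by
              have hxW : x ∉ W := fun h => hx (hW h)
              refine add_mem (coord_mem_squarefreeForms (by simp [hxW])) ?_
              exact squarefreeForms_mono _ (sdiff_subset_sdiff (subset_insert _ _) le_rfl) hm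
            have hl0 : (fun P : ι → Fˣ => (P x : F) + m P) ≠ 0 := by
              intro h0
              refine hf0 ?_
              ext P
              have := congrFun h0 P
              simp only [Pi.zero_apply] at this ⊢
              rw [this, mul_zero]
            -- The cofactor lives outside `W`, so its density multiplies that of `g`. It is at least
            -- the four-term density unless the cofactor is a binomial, which is then the missing
            -- factor.
            rcases torusCount_linearForm_dichotomy hl hl0 with
              h6 | ⟨y, hy, z, hz, hyz, a, b, ha, hb, h6⟩
            · left
              have h7 := h1.torusCount_and (p := fun P => (P x : F) + m P ≠ 0) (by
                intro z hz P u
                have := ignoresCoord_of_mem_squarefreeForms hl (x := z) (by simp [hz]) P u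
                simp_all)
              have h8 : torusCount (fun P : ι → Fˣ => g P * ((P x : F) + m P) ≠ 0) =
                  torusCount (fun P => (P x : F) + m P ≠ 0 ∧ g P ≠ 0) := by
                congr 1
                ext P
                rw [mul_ne_zero_iff, and_comm]
              rw [h8, h7, pow_succ]
              have := mul_le_mul_of_nonneg_left h6 (pow_nonneg hr k)
              linarith
            · right
              rw [mem_sdiff] at hy hz
              refine ⟨insert y (insert z W), ?_, ?_⟩
              · exact insert_subset hy.1 (insert_subset hz.1 (hW.trans (subset_insert _ _)))
              · have h7 : (fun P : ι → Fˣ => g P * ((P x : F) + m P)) =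
                    fun P => g P * (a * (P y : F) + b * (P z : F)) := by
                  ext P
                  rw [← congrFun h6 P]
                rw [h7]
                exact h1.mul hy.2 hz.2 hyz ha hb

theorem exists_torusCount_eq_min {k : ℕ} (hk : 2 * k ≤ Fintype.card ι) :
    ∃ f ∈ squarefreeForms F k (univ : Finset ι), torusCount (fun P => f P ≠ 0) =
      (1 - 1 / (Fintype.card Fˣ : ℝ)) ^ k * (Fintype.card Fˣ : ℝ) ^ Fintype.card ι := by
  obtain ⟨W, g, hg⟩ := exists_isBinomialProduct (F := F) k hk
  exact ⟨g, squarefreeForms_mono _ (subset_univ _) hg.mem_squarefreeForms, hg.torusCount_ne_zero⟩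

theorem exists_torusCount_eq_next {k : ℕ} (hk : 2 * (k + 1) + 2 ≤ Fintype.card ι) :
    ∃ f ∈ squarefreeForms F (k + 1) (univ : Finset ι), torusCount (fun P => f P ≠ 0) =
      (1 - 1 / (Fintype.card Fˣ : ℝ)) ^ (k + 1) * (1 + 1 / (Fintype.card Fˣ : ℝ) ^ 2) *
        (Fintype.card Fˣ : ℝ) ^ Fintype.card ι := by
  obtain ⟨W, g, hg⟩ := exists_isBinomialProduct (ι := ι) (F := F) k (by omega)
  -- Four terms attain the bound of `linearDensity_ge`; room for them beside the `2 * k` variables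
  -- of `W` is exactly the hypothesis `hk`.
  obtain ⟨S, hS, hS4⟩ := exists_subset_card_eq (s := Wᶜ) (n := 4) (by
    rw [card_compl, hg.card]; omega)
  set l : (ι → Fˣ) → F := fun P => ∑ i ∈ S, (1 : ι → F) i * (P i : F) with hl
  have hlm : l ∈ squarefreeForms F 1 S := linearForm_mem_squarefreeForms subset_rfl 1
  have hd : Disjoint W S := disjoint_left.2 fun i hi hiS => by simpa [hi] using hS hiS
  refine ⟨g * l, squarefreeForms_mono _ (subset_univ _)
    (mul_mem_squarefreeForms hd hg.mem_squarefreeForms hlm), ?_⟩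
  have h1 := hg.torusCount_and (p := fun P => l P ≠ 0) (by
    intro z hz P u
    simp only [ignoresCoord_of_mem_squarefreeForms hlm (disjoint_left.1 hd hz) P u])
  have h2 : torusCount (fun P => l P ≠ 0) = _ :=
    torusCount_linearForm (1 : ι → F) S (by simp)
  rw [hS4, linearDensity_four card_units_pos] at h2
  rw [h2] at h1
  rw [pow_succ]
  refine Eq.trans ?_ (h1.trans (by ring))
  congr 1
  ext P
  rw [Pi.mul_apply, mul_ne_zero_iff, and_comm]

end BinomialProducts
-- From the hypersimplex code to squarefree forms
section HypersimplexCode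

variable {F : Type*} [Field F] [Fintype F] [DecidableEq F]

/-- These conditions suffice to identify the lattice points, since exponents are natural numbers and
hence nonnegative. -/
theorem hypersimplex_bounds {s d : ℕ} {x : Fin s → ℝ} (hx : x ∈ hypersimplex s d) :
    (∀ i, x i ≤ 1) ∧ ∑ i, x i = d := by
  have hc : Convex ℝ {x : Fin s → ℝ | (∀ i, x i ≤ 1) ∧ ∑ i, x i = d} := by
    rintro y ⟨hy, hy'⟩ z ⟨hz, hz'⟩ a b ha hb hab
    refine ⟨fun i => ?_, ?_⟩
    · have := mul_le_mul_of_nonneg_left (hy i) ha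
      have := mul_le_mul_of_nonneg_left (hz i) hb
      simp only [Pi.add_apply, Pi.smul_apply, smul_eq_mul]
      linarith
    · simp only [Pi.add_apply, Pi.smul_apply, smul_eq_mul, sum_add_distrib, ← mul_sum, hy', hz']
      rw [← add_mul, hab, one_mul]
  refine convexHull_min ?_ hc hx
  rintro y ⟨T, hT, rfl⟩
  have hval : ∀ i, (∑ j ∈ T, Pi.single j (1 : ℝ) : Fin s → ℝ) i = if i ∈ T then 1 else 0 := by
    intro i
    simp [Finset.sum_apply, Pi.single_apply]
  refine ⟨fun i => ?_, ?_⟩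
  · rw [hval]; split_ifs <;> norm_num
  · simp [hval, hT]

theorem natCast_mem_hypersimplex_iff {s d : ℕ} (α : Fin s →₀ ℕ) :
    (fun i => (α i : ℝ)) ∈ hypersimplex s d ↔
      ∃ T : Finset (Fin s), T.card = d ∧ ∀ i, α i = if i ∈ T then 1 else 0 := by
  constructor
  · intro h
    obtain ⟨h1, h2⟩ := hypersimplex_bounds h
    have h1' : ∀ i, α i ≤ 1 := fun i => by exact_mod_cast h1 i
    have hα : ∀ i, α i = if i ∈ univ.filter (fun i => α i = 1) then 1 else 0 := by
      intro i
      have := h1' i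
      by_cases h : α i = 1
      · simp [h]
      · simp only [mem_filter, mem_univ, true_and, h, if_false]; omega
    refine ⟨univ.filter fun i => α i = 1, ?_, hα⟩
    have h2' : ∑ i, α i = d := by exact_mod_cast h2
    rw [← h2', sum_congr rfl fun i _ => hα i]
    simp
  · rintro ⟨T, hT, hα⟩
    refine subset_convexHull ℝ _ ⟨T, hT, ?_⟩
    ext i
    simp [hα, Finset.sum_apply, Pi.single_apply]

theorem hypersimplexCode_eq_span (s d : ℕ) :
    hypersimplexCode F s d = Submodule.span F
      {v | ∃ T : Finset (Fin s), T.card = d ∧ v = fun P : torus F s => ∏ i ∈ T, P.1 i} := by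
  rw [hypersimplexCode, toricCode, toricSpace, Submodule.map_span]
  congr 1
  have heval : ∀ (α : Fin s →₀ ℕ) (T : Finset (Fin s)),
      (∀ i, α i = if i ∈ T then 1 else 0) →
      evaluationMap (torus F s) (Ideal.Quotient.mk (MvPolynomial.vanishingIdeal F (torus F s))
        (MvPolynomial.monomial α (1 : F))) = fun P : torus F s => ∏ i ∈ T, P.1 i := by
    intro α T hα
    ext P
    change MvPolynomial.aeval (P : Fin s → F) (MvPolynomial.monomial α (1 : F)) = _
    rw [MvPolynomial.aeval_monomial, map_one, one_mul, Finsupp.prod_fintype _ _ (by simp)]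
    simp [hα, pow_ite, prod_ite_mem]
  ext v
  constructor
  · rintro ⟨y, ⟨α, hα, rfl⟩, rfl⟩
    obtain ⟨T, hT, hαT⟩ := (natCast_mem_hypersimplex_iff α).1 hα
    exact ⟨T, hT, heval α T hαT⟩
  · rintro ⟨T, hT, rfl⟩
    have hα : ∀ i, (Finsupp.equivFunOnFinite.symm fun i => if i ∈ T then 1 else 0 :
        Fin s →₀ ℕ) i = if i ∈ T then 1 else 0 := fun i => rfl
    exact ⟨_, ⟨_, (natCast_mem_hypersimplex_iff _).2 ⟨T, hT, hα⟩, rfl⟩, heval _ T hα⟩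

/-- Points of the torus, as families of units. -/
noncomputable def unitsEquivTorus (F : Type*) [Field F] (s : ℕ) : (Fin s → Fˣ) ≃ torus F s where
  toFun P := ⟨fun i => (P i : F), fun i => (P i).ne_zero⟩
  invFun P i := Units.mk0 (P.1 i) (P.2 i)
  left_inv P := by ext; simp
  right_inv P := by ext; simp

/-- The standard Cremona transformation on functions on the torus: invert all coordinates and
multiply by the product of all of them. -/
noncomputable def cremona (F : Type*) [Field F] (s : ℕ) :
    (torus F s → F) ≃ₗ[F] ((Fin s → Fˣ) → F) where
  toFun v P := v (unitsEquivTorus F s P⁻¹) * ∏ i, (P i : F)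
  invFun f P := f ((unitsEquivTorus F s).symm P)⁻¹ * ∏ i, P.1 i
  map_add' v w := by ext P; simp [add_mul]
  map_smul' c v := by ext P; simp [mul_assoc]
  left_inv v := by
    ext P
    have : ∏ i, P.1 i ≠ 0 := prod_ne_zero_iff.2 fun i _ => P.2 i
    simp [unitsEquivTorus, this]
  right_inv f := by
    ext P
    have : ∏ i, (P i : F) ≠ 0 := prod_ne_zero_iff.2 fun i _ => (P i).ne_zero
    have hinv : ((unitsEquivTorus F s).symm (unitsEquivTorus F s P⁻¹))⁻¹ = P := by simp
    have hprod : (∏ i, (unitsEquivTorus F s P⁻¹).1 i) * ∏ i, (P i : F) = 1 := by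
      simp [unitsEquivTorus, this]
    beta_reduce
    rw [hinv, mul_assoc, hprod, mul_one]

theorem cremona_prod {s : ℕ} (T : Finset (Fin s)) :
    cremona F s (fun P => ∏ i ∈ T, P.1 i) = fun P => ∏ i ∈ Tᶜ, (P i : F) := by
  ext P
  have h : ∏ i ∈ T, (P i : F) ≠ 0 := prod_ne_zero_iff.2 fun i _ => (P i).ne_zero
  change (∏ i ∈ T, ((P⁻¹ i : Fˣ) : F)) * ∏ i, (P i : F) = _
  rw [← prod_mul_prod_compl T (fun i => (P i : F))]
  simp [h]

theorem map_cremona_hypersimplexCode {s d : ℕ} (hds : d ≤ s) :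
    (hypersimplexCode F s d).map (cremona F s : (torus F s → F) →ₗ[F] _) =
      squarefreeForms F (s - d) (univ : Finset (Fin s)) := by
  rw [hypersimplexCode_eq_span, Submodule.map_span, squarefreeForms]
  congr 1
  ext f
  constructor
  · rintro ⟨v, ⟨T, hT, rfl⟩, rfl⟩
    exact ⟨Tᶜ, subset_univ _, by rw [card_compl, Fintype.card_fin, hT], cremona_prod T⟩
  · rintro ⟨T, -, hT, rfl⟩
    refine ⟨_, ⟨Tᶜ, ?_, rfl⟩, ?_⟩
    · rw [card_compl, Fintype.card_fin, hT]; omega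
    · exact (cremona_prod Tᶜ).trans (by rw [compl_compl])

/-- Inversion permutes the torus, and the factor `∏ i, P i` never vanishes. -/
theorem hammingNorm_eq_torusCount {s : ℕ} (v : torus F s → F) :
    (hammingNorm v : ℝ) = torusCount (fun P => cremona F s v P ≠ 0) := by
  classical
  rw [torusCount_eq_card, hammingNorm]
  congr 1
  refine (card_equiv ((Equiv.inv _).trans (unitsEquivTorus F s)) fun P => ?_).symm
  simp [cremona, prod_ne_zero_iff]

theorem mem_hypersimplexCode_iff {s d : ℕ} (hds : d ≤ s) (v : torus F s → F) :
    v ∈ hypersimplexCode F s d ↔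
      cremona F s v ∈ squarefreeForms F (s - d) (univ : Finset (Fin s)) := by
  rw [← map_cremona_hypersimplexCode hds]
  exact ⟨fun h => Submodule.mem_map_of_mem h,
    fun ⟨w, hw, h⟩ => (cremona F s).injective h ▸ hw⟩

theorem mem_nonzeroWeights_hypersimplexCode {s d : ℕ} (hds : d ≤ s) (w : ℕ) :
    w ∈ nonzeroWeights (hypersimplexCode F s d) ↔
      ∃ f ∈ squarefreeForms F (s - d) (univ : Finset (Fin s)), f ≠ 0 ∧
        torusCount (fun P => f P ≠ 0) = w := by
  constructor
  · rintro ⟨v, hv, hv0, rfl⟩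
    exact ⟨cremona F s v, (mem_hypersimplexCode_iff hds v).1 hv, by simpa using hv0,
      (hammingNorm_eq_torusCount v).symm⟩
  · rintro ⟨f, hf, hf0, hw⟩
    refine ⟨(cremona F s).symm f, ?_, by simpa using hf0, ?_⟩
    · rw [mem_hypersimplexCode_iff hds, LinearEquiv.apply_symm_apply]
      exact hf
    · have := hammingNorm_eq_torusCount ((cremona F s).symm f)
      rw [LinearEquiv.apply_symm_apply, hw] at this
      exact_mod_cast this

end HypersimplexCode

/-! ### The next-to-minimal weight -/

theorem corollary4p5 (F : Type*) [Field F] [Fintype F] [DecidableEq F] (q s d : ℕ)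
    (hF : Fintype.card F = q) (hq : 4 ≤ q) (hds : d < s) (hd : s + 2 ≤ 2 * d) :
    IsNextToMinimalWeight (hypersimplexCode F s d)
      ((q - 2) ^ (s - d) * (q - 1) ^ d + (q - 2) ^ (s - d) * (q - 1) ^ (d - 2)) := by
  have hcard : Fintype.card Fˣ = q - 1 := by rw [Fintype.card_units, hF]
  obtain ⟨k, hk⟩ : ∃ k, s - d = k + 1 := ⟨s - d - 1, by omega⟩
  obtain ⟨e, rfl⟩ : ∃ e, d = e + 2 := ⟨d - 2, by omega⟩
  obtain ⟨n, rfl⟩ : ∃ n, q = n + 2 := ⟨q - 2, by omega⟩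
  have hs : s = k + 1 + (e + 2) := by omega
  have h3 : 3 ≤ Fintype.card Fˣ := by omega
  have hQ : (Fintype.card Fˣ : ℝ) = n + 1 := by
    rw [hcard, show n + 2 - 1 = n + 1 by omega]; push_cast; ring
  have hn : 0 < n := by omega
  -- With `n = q - 2`, the density is `(n / (n + 1)) ^ (k + 1)`; its denominator cancels against `(n
  -- + 1) ^ s`, leaving exponent `d = e + 2`.
  have hmin : (1 - 1 / (Fintype.card Fˣ : ℝ)) ^ (k + 1) *
      (Fintype.card Fˣ : ℝ) ^ Fintype.card (Fin s) =
        ((n ^ (k + 1) * (n + 1) ^ (e + 2) : ℕ) : ℝ) := by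
    have : (1 - 1 / (n + 1 : ℝ)) = n / (n + 1) := by field_simp; ring
    rw [Fintype.card_fin, hQ, this, hs, pow_add (n + 1 : ℝ) (k + 1), ← mul_assoc, ← mul_pow,
      div_mul_cancel₀ _ (by positivity)]
    push_cast
    rfl
  have hnext : (1 - 1 / (Fintype.card Fˣ : ℝ)) ^ (k + 1) *
      (1 + 1 / (Fintype.card Fˣ : ℝ) ^ 2) * (Fintype.card Fˣ : ℝ) ^ Fintype.card (Fin s) =
        ((n ^ (k + 1) * (n + 1) ^ (e + 2) + n ^ (k + 1) * (n + 1) ^ e : ℕ) : ℝ) := by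
    rw [mul_right_comm, hmin, hQ]
    push_cast
    rw [pow_add (n + 1 : ℝ) e 2]
    field_simp
  have hlt : n ^ (k + 1) * (n + 1) ^ (e + 2) <
      n ^ (k + 1) * (n + 1) ^ (e + 2) + n ^ (k + 1) * (n + 1) ^ e := by
    have : 0 < n ^ (k + 1) * (n + 1) ^ e := by positivity
    omega
  have hne : ∀ f : (Fin s → Fˣ) → F, 0 < torusCount (fun P => f P ≠ 0) → f ≠ 0 := by
    rintro f h rfl
    simp [torusCount] at h
  rw [show n + 2 - 2 = n by omega, show n + 2 - 1 = n + 1 by omega, show e + 2 - 2 = e by omega,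
    hk]
  refine ⟨n ^ (k + 1) * (n + 1) ^ (e + 2), ⟨?_, ?_⟩, ⟨?_, ?_⟩, ?_⟩
  · rw [mem_nonzeroWeights_hypersimplexCode hds.le, hk]
    obtain ⟨f, hf, hfc⟩ := exists_torusCount_eq_min (ι := Fin s) (F := F) (k := k + 1)
      (by rw [Fintype.card_fin]; omega)
    rw [hmin] at hfc
    exact ⟨f, hf, hne f (by rw [hfc]; positivity), hfc⟩
  · intro w hw
    rw [mem_nonzeroWeights_hypersimplexCode hds.le, hk] at hw
    obtain ⟨f, hf, hf0, hfc⟩ := hw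
    have := le_torusCount_of_mem_squarefreeForms hf hf0
    rw [hmin, hfc] at this
    exact_mod_cast this
  · rw [mem_nonzeroWeights_hypersimplexCode hds.le, hk]
    obtain ⟨f, hf, hfc⟩ := exists_torusCount_eq_next (ι := Fin s) (F := F) (k := k)
      (by rw [Fintype.card_fin]; omega)
    rw [hnext] at hfc
    exact ⟨f, hf, hne f (by rw [hfc]; positivity), hfc⟩
  · exact hlt.ne'
  · rintro w ⟨hw, hwδ⟩
    rw [mem_nonzeroWeights_hypersimplexCode hds.le, hk] at hw
    obtain ⟨f, hf, hf0, hfc⟩ := hw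
    -- A binomial product has exactly the minimum weight, which `hwδ` excludes.
    rcases torusCount_dichotomy h3 hf hf0 with h | ⟨W, -, hW⟩
    · rw [hnext, hfc] at h
      exact_mod_cast h
    · have h := hW.torusCount_ne_zero
      rw [hmin, hfc] at h
      exact absurd (by exact_mod_cast h) hwδ
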